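/- Let $K\ge 2$, $n\ge 1$ and $d\ge K-1$ be integers. For $W\in\mathbb R^{K\times d}$ with rows $w_1,\dots,w_K$ and $H\in\mathbb R^{d\times Kn}$ with columns $h_{k,i}$ ($1\le k\le K$, $1\le i\le n$), let $$\mathcal L(W,H)=-\sum_{k=1}^K\sum_{i=1}^n\log\left(\frac{\exp(w_k^\top h_{k,i})}{\sum_{j=1}^K\exp(w_j^\top h_{k,i})}\right),\qquad \bar h_k=\frac1n\sum_{i=1}^n h_{k,i}.$$ The tangent space at $(W,H)$ is $$\mathcal T(W,H)=\{(\Delta W,\Delta H)\in\mathbb R^{K\times d}\times\mathbb R^{d\times Kn}:\ \mathrm{tr}(W^\top\Delta W)+\mathrm{tr}(H^\top\Delta H)=0\}.$$ Call $(W,H)$ a neural collapse solution if (NC1) $h_{k,i}=\bar h_k$ for all $k,i$; (NC2) the class means $\bar h_k$ are nonzero with $\|\bar h_k\|=\|\bar h_j\|$ and $\cos(\bar h_k,\bar h_j)=-\frac1{K-1}$ for all $k\ne j$; (NC3) there is $C>0$ with $w_k=C\bar h_k$ for all $k$; and (NC4) $\arg\max_k\langle w_k,h\rangle=\arg\min_k\|h-\bar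 h_k\|$, as sets of indices, for every $h\in\mathbb R^d$. Suppose that $(W,H)$ is not a neural collapse solution or that $\|W\|_F\neq\|H\|_F$. Then the following hold. 1. There are a direction $(\Delta W,\Delta H)\in\mathcal T(W,H)$ and a constant $M>0$ such that $\mathcal L(W+\delta\Delta W,H+\delta\Delta H)<\mathcal L(W,H)$ for all $0<\delta<M$. 2. If $(W,H)\ne(0,0)$, then for every $\epsilon>0$ there is a point $(W',H')$ with $$\|W'\|_F^2+\|H'\|_F^2=\|W\|_F^2+\|H\|_F^2,\quad \|W'-W\|_F^2+\|H'-H\|_F^2<\epsilon,\quad \mathcal L(W',H')<\mathcal L(W,H).$$ 3. If $(W,H)$ is a critical point in the tangent space, i.e. $\frac{d}{dt}\mathcal L(W+t\Delta W,H+t\Delta H)|_{t=0}=0$ for all $(\Delta W,\Delta H)\in\mathcal T(W,H)$, then it is a strict saddle in the tangent space: there is $(\Delta W,\Delta H)\in\mathcal T(W,H)$ with $\frac{d^2}{dt^2}\mathcal L(W+t\Delta W,H+t\Delta H)|_{t=0}<0$; and, if $(W,H)\neq(0,0)$, there is $(\Delta W,\Delta H)\in\mathcal T(W,H)$ with $\|\Delta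 W\|_F^2+\|\Delta H\|_F^2=\|W\|_F^2+\|H\|_F^2$ such that the second derivative at $t=0$ of $\mathcal L$ along the great circle $t\mapsto\cos t\,(W,H)+\sin t\,(\Delta W,\Delta H)$ is negative, i.e. the Riemannian Hessian of $\mathcal L$ on the sphere through $(W,H)$ has a negative eigenvalue. -/

import Mathlib

/-!
Write `G` for the gradient of the cross-entropy with respect to the logits `Z = W * H`; its columns
are differences of probability vectors, so they sum to zero. At a critical point in the tangent
space there is a Lagrange multiplier `lam` with `G * Hᵀ = -lam • W` and `Wᵀ * G = -lam • H`.

* If `lam < 0`, the Hessian is negative in the direction `(W, -H)`, which fixes the logits to first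
  order.
* If `0 ≤ lam` and `G` has operator norm larger than `lam`, some `u` orthogonal to the all-ones
  vector is expanded by more than `lam`. On `range W + span 1` the matrix `G` expands by at most
  `lam`, so this subspace is proper, and since `K ≤ d + 1` there is `a ≠ 0` with `W *ᵥ a ∈ span 1`.
  The rank-one direction `(u aᵀ, -s • a (u ᵥ* G))` then has negative curvature for a suitable `s`.
* If `0 ≤ lam` and `G` has operator norm at most `lam`, then `lam > 0`, and convexity of the loss in
  the logits shows that `(W, H)` minimises the loss among pairs of the same norm, with logits unique
  up to adding a constant to each column. Relabelling the classes and the samples preserves the loss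
  and the norm, hence fixes the logits. A matrix of logits with this symmetry is a multiple of the
  simplex frame, so `(W, H)` is a neural collapse solution, and `lam ≠ 0` forces `‖W‖ = ‖H‖`.
-/

open scoped Matrix

attribute [local instance] Matrix.frobeniusNormedAddCommGroup

namespace ULPM

/-- The matrix of classifiers: its `k`-th row is the classifier `w_k` of class `k`. -/
abbrev Classifiers (K d : ℕ) : Type := Matrix (Fin K) (Fin d) ℝ

/-- The matrix of features: its column `(k, i)` is the feature `h_{k,i}` of the `i`-th data point
of class `k`. -/
abbrev Features (K n d : ℕ) : Type := Matrix (Fin d) (Fin K × Fin n) ℝ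

noncomputable section

variable {K n d : ℕ}

/-- The cross-entropy loss of the unconstrained layer-peeled model. -/
def loss (W : Classifiers K d) (H : Features K n d) : ℝ :=
  -∑ k : Fin K, ∑ i : Fin n,
    Real.log (Real.exp ((W * H) k (k, i)) / ∑ j : Fin K, Real.exp ((W * H) j (k, i)))

/-- The classifier `w_k`, as a vector of Euclidean space. -/
def classifier (W : Classifiers K d) (k : Fin K) : EuclideanSpace ℝ (Fin d) :=
  WithLp.toLp 2 (fun a => W k a)

/-- The feature `h_{k,i}`, as a vector of Euclidean space. -/
def feature (H : Features K n d) (k : Fin K) (i : Fin n) : EuclideanSpace ℝ (Fin d) :=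
  WithLp.toLp 2 (fun a => H a (k, i))

/-- The mean of the features of class `k`. -/
def classMean (H : Features K n d) (k : Fin K) : EuclideanSpace ℝ (Fin d) :=
  (n : ℝ)⁻¹ • ∑ i : Fin n, feature H k i

/-- The neural collapse conditions. The cosine is that of Mathlib's angle; it is `0` when one of the
vectors is zero, so that `nc2` never holds for vanishing class means. -/
structure IsNeuralCollapse (W : Classifiers K d) (H : Features K n d) : Prop where
  /-- variability collapse -/
  nc1 : ∀ (k : Fin K) (i : Fin n), ‖feature H k i - classMean H k‖ = 0
  /-- the class means form a simplex equiangular tight frame -/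
  nc2 : ∀ k j : Fin K, k ≠ j →
    Real.cos (InnerProductGeometry.angle (classMean H k) (classMean H j)) = -1 / ((K : ℝ) - 1) ∧
      ‖classMean H k‖ = ‖classMean H j‖
  /-- self-duality -/
  nc3 : ∃ C : ℝ, 0 < C ∧ ∀ k : Fin K, classifier W k = C • classMean H k
  /-- the classifier chooses the class with the nearest class mean -/
  nc4 : ∀ (h : EuclideanSpace ℝ (Fin d)) (k : Fin K),
    (∀ j : Fin K, inner ℝ (classifier W j) h ≤ inner ℝ (classifier W k) h) ↔
      ∀ j : Fin K, ‖h - classMean H k‖ ≤ ‖h - classMean H j‖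

/-- The squared norm `‖W‖_F² + ‖H‖_F²` of a point. -/
def normSq (W : Classifiers K d) (H : Features K n d) : ℝ := ‖W‖ ^ 2 + ‖H‖ ^ 2

/-- The tangent space: the directions that are orthogonal to `(W, H)`. -/
def tangentSpace (W : Classifiers K d) (H : Features K n d) :
    Set (Classifiers K d × Features K n d) :=
  {Δ | (Wᵀ * Δ.1).trace + (Hᵀ * Δ.2).trace = 0}

/-- `(W, H)` is a critical point in the tangent space: the derivative of the loss at `(W, H)`
vanishes in every tangent direction. -/
def IsTangentCritical (W : Classifiers K d) (H : Features K n d) : Prop :=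
  ∀ Δ ∈ tangentSpace W H, deriv (fun t : ℝ => loss (W + t • Δ.1) (H + t • Δ.2)) 0 = 0

/-- `(W, H)` is a strict saddle in the tangent space: a critical point such that the Hessian of the
loss is negative in some tangent direction and, unless the sphere through `(W, H)` degenerates to
the origin, the Riemannian Hessian of the loss on that sphere (its second derivative along
geodesics, which are great circles) is negative in some tangent direction. -/
def IsTangentStrictSaddle (W : Classifiers K d) (H : Features K n d) : Prop :=
  IsTangentCritical W H ∧
  (∃ Δ ∈ tangentSpace W H,
    iteratedDeriv 2 (fun t : ℝ => loss (W + t • Δ.1) (H + t • Δ.2)) 0 < 0) ∧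
  ((W, H) ≠ 0 → ∃ Δ ∈ tangentSpace W H, normSq Δ.1 Δ.2 = normSq W H ∧
    iteratedDeriv 2 (fun t : ℝ =>
      loss (Real.cos t • W + Real.sin t • Δ.1) (Real.cos t • H + Real.sin t • Δ.2)) 0 < 0)

end

end ULPM

namespace ULPM

section Frobenius

variable {m l o : Type*} [Fintype m] [Fintype l] [Fintype o]

/-- The Frobenius inner product of real matrices, as a bilinear form. -/
noncomputable def frob : LinearMap.BilinForm ℝ (Matrix m l ℝ) :=
  LinearMap.mk₂ ℝ (fun A B => (Aᵀ * B).trace)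
    (fun A B C => by rw [Matrix.transpose_add, Matrix.add_mul, Matrix.trace_add])
    (fun c A B => by rw [Matrix.transpose_smul, Matrix.smul_mul, Matrix.trace_smul])
    (fun A B C => by rw [Matrix.mul_add, Matrix.trace_add])
    (fun c A B => by rw [Matrix.mul_smul, Matrix.trace_smul])

theorem frob_eq_sum (A B : Matrix m l ℝ) : frob A B = ∑ x, ∑ j, A j x * B j x := by
  simp [frob, Matrix.trace, Matrix.mul_apply]

theorem frob_comm (A B : Matrix m l ℝ) : frob A B = frob B A := by
  simp only [frob_eq_sum, mul_comm]

theorem frob_self (A : Matrix m l ℝ) : frob A A = ‖A‖ ^ 2 := by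
  rw [frob_eq_sum, Finset.sum_comm, Matrix.frobenius_norm_def, ← Real.sqrt_eq_rpow,
    Real.sq_sqrt (by positivity)]
  simp [sq]

theorem frob_self_nonneg (A : Matrix m l ℝ) : 0 ≤ frob A A :=
  frob_self A ▸ sq_nonneg _

theorem frob_self_eq_zero {A : Matrix m l ℝ} : frob A A = 0 ↔ A = 0 := by
  rw [frob_self, sq_eq_zero_iff, norm_eq_zero]

theorem eq_of_frob_eq {A B : Matrix m l ℝ} (h : ∀ D, frob A D = frob B D) : A = B := by
  rw [← sub_eq_zero, ← frob_self_eq_zero, map_sub frob, LinearMap.sub_apply, h, sub_self]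

theorem frob_mul_transpose_left (G : Matrix m l ℝ) (H : Matrix o l ℝ) (D : Matrix m o ℝ) :
    frob (G * Hᵀ) D = frob G (D * H) := by
  change ((G * Hᵀ)ᵀ * D).trace = (Gᵀ * (D * H)).trace
  rw [Matrix.transpose_mul, Matrix.transpose_transpose, Matrix.mul_assoc, Matrix.trace_mul_comm,
    Matrix.mul_assoc]

theorem frob_transpose_mul_left (W : Matrix m o ℝ) (G : Matrix m l ℝ) (D : Matrix o l ℝ) :
    frob (Wᵀ * G) D = frob G (W * D) := by
  change ((Wᵀ * G)ᵀ * D).trace = (Gᵀ * (W * D)).trace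
  rw [Matrix.transpose_mul, Matrix.transpose_transpose, Matrix.mul_assoc]

theorem frob_vecMulVec_right (G : Matrix m l ℝ) (u : m → ℝ) (v : l → ℝ) :
    frob G (Matrix.vecMulVec u v) = (u ᵥ* G) ⬝ᵥ v := by
  simp only [frob_eq_sum, Matrix.vecMulVec_apply, dotProduct, Matrix.vecMul, Finset.sum_mul]
  exact Finset.sum_congr rfl fun x _ => Finset.sum_congr rfl fun j _ => by ring

theorem frob_vecMulVec_self (u : m → ℝ) (v : l → ℝ) :
    frob (Matrix.vecMulVec u v) (Matrix.vecMulVec u v) = (u ⬝ᵥ u) * (v ⬝ᵥ v) := by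
  rw [frob_vecMulVec_right, Matrix.vecMul_vecMulVec, smul_dotProduct, smul_eq_mul]

theorem frob_submatrix {m' l' : Type*} [Fintype m'] [Fintype l'] (A B : Matrix m l ℝ)
    (σ : m' ≃ m) (ρ : l' ≃ l) : frob (A.submatrix σ ρ) (B.submatrix σ ρ) = frob A B := by
  simp only [frob_eq_sum, Matrix.submatrix_apply]
  rw [Equiv.sum_comp ρ fun x => ∑ j, A (σ j) x * B (σ j) x]
  exact Finset.sum_congr rfl fun x _ => Equiv.sum_comp σ fun j => A j x * B j x

end Frobenius

section Softmax

variable {ι : Type*} [Fintype ι]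

/-- The log-sum-exp function, the cumulant function of the softmax distribution. -/
noncomputable def logSumExp (z : ι → ℝ) : ℝ := Real.log (∑ j, Real.exp (z j))

/-- The softmax distribution with logits `z`. -/
noncomputable def softmax (z : ι → ℝ) (j : ι) : ℝ := Real.exp (z j) / ∑ k, Real.exp (z k)

/-- The variance of `a` under the softmax distribution with logits `z`, which is the second
derivative of `logSumExp` at `z` in the direction `a`. -/
noncomputable def softmaxVar (z a : ι → ℝ) : ℝ := softmax z ⬝ᵥ a ^ 2 - (softmax z ⬝ᵥ a) ^ 2

theorem softmaxVar_smul (r : ℝ) (z a : ι → ℝ) : softmaxVar z (r • a) = r ^ 2 * softmaxVar z a := by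
  rw [softmaxVar, softmaxVar, smul_pow, dotProduct_smul, dotProduct_smul, smul_eq_mul, smul_eq_mul]
  ring

theorem logSumExp_comp_equiv (z : ι → ℝ) (σ : Equiv.Perm ι) : logSumExp (z ∘ σ) = logSumExp z :=
  congrArg Real.log (Equiv.sum_comp σ fun j => Real.exp (z j))

theorem softmax_comp_equiv (z : ι → ℝ) (σ : Equiv.Perm ι) : softmax (z ∘ σ) = softmax z ∘ σ :=
  funext fun j => congrArg (Real.exp (z (σ j)) / ·) (Equiv.sum_comp σ fun k => Real.exp (z k))

variable [Nonempty ι]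

theorem sum_exp_pos (z : ι → ℝ) : 0 < ∑ j, Real.exp (z j) :=
  Finset.sum_pos (fun _ _ => Real.exp_pos _) Finset.univ_nonempty

theorem softmax_pos (z : ι → ℝ) (j : ι) : 0 < softmax z j :=
  div_pos (Real.exp_pos _) (sum_exp_pos z)

theorem sum_softmax (z : ι → ℝ) : ∑ j, softmax z j = 1 := by
  simp only [softmax, ← Finset.sum_div]
  exact div_self (sum_exp_pos z).ne'

theorem softmaxVar_add_const (z a : ι → ℝ) (c : ℝ) :
    softmaxVar z (a + fun _ => c) = softmaxVar z a := by
  have hmean : softmax z ⬝ᵥ (a + fun _ => c) = softmax z ⬝ᵥ a + c := by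
    rw [dotProduct_add, dotProduct, dotProduct, ← Finset.sum_mul, sum_softmax, one_mul]
  have hsq : softmax z ⬝ᵥ (a + fun _ => c) ^ 2
      = softmax z ⬝ᵥ a ^ 2 + 2 * c * (softmax z ⬝ᵥ a) + c ^ 2 := by
    calc ∑ j, softmax z j * (a j + c) ^ 2
        = ∑ j, (softmax z j * a j ^ 2 + 2 * c * (softmax z j * a j) + softmax z j * c ^ 2) :=
          Finset.sum_congr rfl fun j _ => by ring
      _ = _ := by
          rw [Finset.sum_add_distrib, Finset.sum_add_distrib, ← Finset.mul_sum, ← Finset.sum_mul,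
            sum_softmax, one_mul]
          rfl
  rw [softmaxVar, softmaxVar, hmean, hsq]
  ring

theorem logSumExp_add_sub (z a : ι → ℝ) :
    logSumExp (z + a) - logSumExp z = Real.log (∑ j, softmax z j * Real.exp (a j)) := by
  rw [logSumExp, logSumExp, ← Real.log_div (sum_exp_pos _).ne' (sum_exp_pos _).ne',
    Finset.sum_div]
  simp only [softmax, Pi.add_apply, Real.exp_add, div_mul_eq_mul_div]

theorem dotProduct_softmax_le (z a : ι → ℝ) :
    softmax z ⬝ᵥ a ≤ logSumExp (z + a) - logSumExp z := by
  rw [logSumExp_add_sub, Real.le_log_iff_exp_le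
    (Finset.sum_pos (fun j _ => mul_pos (softmax_pos z j) (Real.exp_pos _)) Finset.univ_nonempty)]
  exact convexOn_exp.map_sum_le (fun j _ => (softmax_pos z j).le) (sum_softmax z)
    fun _ _ => Set.mem_univ _

theorem eq_const_of_logSumExp_le {z a : ι → ℝ}
    (h : logSumExp (z + a) - logSumExp z ≤ softmax z ⬝ᵥ a) (j : ι) : a j = softmax z ⬝ᵥ a := by
  have hlog := h.antisymm (dotProduct_softmax_le z a)
  rw [logSumExp_add_sub] at hlog
  have hexp : Real.exp (∑ j, softmax z j • a j) = ∑ j, softmax z j • Real.exp (a j) := by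
    change Real.exp (softmax z ⬝ᵥ a) = _
    rw [← hlog, Real.exp_log (Finset.sum_pos
      (fun j _ => mul_pos (softmax_pos z j) (Real.exp_pos _)) Finset.univ_nonempty)]
    rfl
  exact (strictConvexOn_exp.map_sum_eq_iff (fun j _ => softmax_pos z j) (sum_softmax z)
    fun _ _ => Set.mem_univ _).1 hexp j (Finset.mem_univ j)

theorem hasDerivAt_logSumExp {z : ℝ → ι → ℝ} {z' : ι → ℝ} {t : ℝ}
    (hz : ∀ j, HasDerivAt (fun s => z s j) (z' j) t) :
    HasDerivAt (fun s => logSumExp (z s)) (softmax (z t) ⬝ᵥ z') t := by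
  refine ((HasDerivAt.fun_sum fun j (_ : j ∈ Finset.univ) => (hz j).exp).log
    (sum_exp_pos (z t)).ne').congr_deriv ?_
  rw [Finset.sum_div]
  exact Finset.sum_congr rfl fun j _ => by rw [softmax]; ring

theorem hasDerivAt_softmax {z : ℝ → ι → ℝ} {z' : ι → ℝ} {t : ℝ}
    (hz : ∀ j, HasDerivAt (fun s => z s j) (z' j) t) (j : ι) :
    HasDerivAt (fun s => softmax (z s) j) (softmax (z t) j * (z' j - softmax (z t) ⬝ᵥ z')) t := by
  have hexp (s : ℝ) : softmax (z s) j = Real.exp (z s j - logSumExp (z s)) := by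
    rw [Real.exp_sub, logSumExp, Real.exp_log (sum_exp_pos _), softmax]
  simp only [hexp]
  exact ((hz j).sub (hasDerivAt_logSumExp hz)).exp

theorem hasDerivAt_dotProduct_softmax {z z' : ℝ → ι → ℝ} {z'' : ι → ℝ} {t : ℝ}
    (hz : ∀ j, HasDerivAt (fun s => z s j) (z' t j) t)
    (hz' : ∀ j, HasDerivAt (fun s => z' s j) (z'' j) t) :
    HasDerivAt (fun s => softmax (z s) ⬝ᵥ z' s)
      (softmaxVar (z t) (z' t) + softmax (z t) ⬝ᵥ z'') t := by
  refine (HasDerivAt.fun_sum fun j (_ : j ∈ Finset.univ) =>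
    (hasDerivAt_softmax hz j).mul (hz' j)).congr_deriv ?_
  have hvar : softmaxVar (z t) (z' t)
      = ∑ j, softmax (z t) j * (z' t j - softmax (z t) ⬝ᵥ z' t) * z' t j := by
    simp only [mul_sub, sub_mul, Finset.sum_sub_distrib, mul_right_comm _ (_ ⬝ᵥ _),
      ← Finset.sum_mul]
    simp only [softmaxVar, dotProduct, Pi.pow_apply, sq, mul_assoc]
  rw [hvar, Finset.sum_add_distrib]
  rfl

end Softmax

section CrossEntropy

variable {ι X : Type*} [Fintype ι]

/-- The total cross-entropy loss of the logits in the columns of `Z`, where `y x` is the label of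
the data point `x`. -/
noncomputable def crossEntropy [Fintype X] (y : X → ι) (Z : Matrix ι X ℝ) : ℝ :=
  ∑ x, (logSumExp (Z.col x) - Z (y x) x)

/-- The gradient of `crossEntropy` with respect to the logits. -/
noncomputable def ceGrad [DecidableEq ι] (y : X → ι) (Z : Matrix ι X ℝ) : Matrix ι X ℝ :=
  Matrix.of fun j x => softmax (Z.col x) j - if j = y x then 1 else 0

/-- The Hessian of `crossEntropy` with respect to the logits, as a quadratic form in `A`. The labels
enter the loss linearly, so it does not depend on them. -/
noncomputable def ceHess [Fintype X] (Z A : Matrix ι X ℝ) : ℝ := ∑ x, softmaxVar (Z.col x) (A.col x)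

section

variable [DecidableEq ι]

theorem ceGrad_submatrix {y : X → ι} {σ : Equiv.Perm ι} {ρ : Equiv.Perm X}
    (hσρ : ∀ x, y (ρ x) = σ (y x)) (Z : Matrix ι X ℝ) :
    ceGrad y (Z.submatrix σ ρ) = (ceGrad y Z).submatrix σ ρ := by
  ext j x
  have hcol : (Z.submatrix σ ρ).col x = Z.col (ρ x) ∘ σ := rfl
  simp only [ceGrad, Matrix.submatrix_apply, Matrix.of_apply, hσρ, σ.injective.eq_iff, hcol,
    softmax_comp_equiv, Function.comp_apply]

theorem ceGrad_ne_zero [Nontrivial ι] [Nonempty X] (y : X → ι) (Z : Matrix ι X ℝ) :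
    ceGrad y Z ≠ 0 := by
  obtain ⟨x⟩ := ‹Nonempty X›
  obtain ⟨j, hj⟩ := exists_ne (y x)
  intro h
  have hjx : softmax (Z.col x) j = 0 := by simpa [ceGrad, hj] using congrFun₂ h j x
  exact (softmax_pos _ j).ne' hjx

variable [Nonempty ι]

theorem one_vecMul_ceGrad (y : X → ι) (Z : Matrix ι X ℝ) : 1 ᵥ* ceGrad y Z = 0 := by
  ext x
  simp [Matrix.vecMul, ceGrad, dotProduct, sum_softmax]

end

variable [Fintype X]

theorem loss_eq_crossEntropy {K n d : ℕ} (W : Classifiers K d) (H : Features K n d) :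
    loss W H = crossEntropy Prod.fst (W * H) := by
  rw [loss, crossEntropy, Fintype.sum_prod_type, ← Finset.sum_neg_distrib]
  refine Finset.sum_congr rfl fun k _ => ?_
  rw [← Finset.sum_neg_distrib]
  refine Finset.sum_congr rfl fun i _ => ?_
  have : Nonempty (Fin K) := ⟨k⟩
  rw [Real.log_div (Real.exp_pos _).ne' (sum_exp_pos _).ne', Real.log_exp, neg_sub]
  rfl

theorem ceHess_smul (r : ℝ) (Z A : Matrix ι X ℝ) : ceHess Z (r • A) = r ^ 2 * ceHess Z A := by
  rw [ceHess, ceHess, Finset.mul_sum]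
  exact Finset.sum_congr rfl fun x _ => softmaxVar_smul r _ _

theorem ceHess_zero (Z : Matrix ι X ℝ) : ceHess Z 0 = 0 := by
  simpa using ceHess_smul 0 Z 0

theorem crossEntropy_submatrix {y : X → ι} {σ : Equiv.Perm ι} {ρ : Equiv.Perm X}
    (hσρ : ∀ x, y (ρ x) = σ (y x)) (Z : Matrix ι X ℝ) :
    crossEntropy y (Z.submatrix σ ρ) = crossEntropy y Z := by
  rw [crossEntropy, crossEntropy, ← Equiv.sum_comp ρ fun x => logSumExp (Z.col x) - Z (y x) x]
  refine Finset.sum_congr rfl fun x _ => ?_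
  rw [hσρ, ← logSumExp_comp_equiv (Z.col (ρ x)) σ]
  rfl

theorem ceHess_add_vecMulVec_one [Nonempty ι] (Z A : Matrix ι X ℝ) (v : X → ℝ) :
    ceHess Z (A + Matrix.vecMulVec 1 v) = ceHess Z A := by
  refine Finset.sum_congr rfl fun x _ => ?_
  rw [← softmaxVar_add_const _ (A.col x) (v x)]
  congr 1
  ext j
  simp

section Gradient

variable [DecidableEq ι]

theorem frob_ceGrad (y : X → ι) (Z A : Matrix ι X ℝ) :
    frob (ceGrad y Z) A = ∑ x, (softmax (Z.col x) ⬝ᵥ A.col x - A (y x) x) := by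
  simp [frob_eq_sum, ceGrad, sub_mul, dotProduct]

variable [Nonempty ι]

theorem exists_sub_eq_vecMulVec_one_of_crossEntropy_le {y : X → ι} {Z Z' : Matrix ι X ℝ}
    (hle : crossEntropy y Z' ≤ crossEntropy y Z) (hgrad : 0 ≤ frob (ceGrad y Z) (Z' - Z)) :
    ∃ v, Z' - Z = Matrix.vecMulVec 1 v := by
  have hcol (x : X) : Z'.col x = Z.col x + (Z' - Z).col x :=
    (add_sub_cancel (Z.col x) (Z'.col x)).symm
  have hnonneg (x : X) : 0 ≤ logSumExp (Z'.col x) - logSumExp (Z.col x)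
      - softmax (Z.col x) ⬝ᵥ (Z' - Z).col x := by
    rw [hcol x]
    exact sub_nonneg.2 (dotProduct_softmax_le _ _)
  have hsum : ∑ x, (logSumExp (Z'.col x) - logSumExp (Z.col x)
      - softmax (Z.col x) ⬝ᵥ (Z' - Z).col x) ≤ 0 := by
    rw [frob_ceGrad] at hgrad
    simp only [crossEntropy, Matrix.sub_apply, Finset.sum_sub_distrib] at hle hgrad ⊢
    linarith
  refine ⟨fun x => softmax (Z.col x) ⬝ᵥ (Z' - Z).col x, Matrix.ext fun j x => ?_⟩
  have hx := (Finset.sum_eq_zero_iff_of_nonneg fun x _ => hnonneg x).1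
    (hsum.antisymm (Finset.sum_nonneg fun x _ => hnonneg x)) x (Finset.mem_univ x)
  rw [hcol x] at hx
  rw [Matrix.vecMulVec_apply, Pi.one_apply, one_mul]
  exact eq_const_of_logSumExp_le (sub_nonpos.1 hx.le) j

theorem hasDerivAt_crossEntropy (y : X → ι) {Z : ℝ → Matrix ι X ℝ} {Z' : Matrix ι X ℝ} {t : ℝ}
    (hZ : ∀ j x, HasDerivAt (fun s => Z s j x) (Z' j x) t) :
    HasDerivAt (fun s => crossEntropy y (Z s)) (frob (ceGrad y (Z t)) Z') t := by
  rw [frob_ceGrad]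
  exact HasDerivAt.fun_sum fun x _ =>
    (hasDerivAt_logSumExp (z := fun s => (Z s).col x) fun j => hZ j x).sub (hZ (y x) x)

theorem hasDerivAt_frob_ceGrad (y : X → ι) {Z Z' : ℝ → Matrix ι X ℝ} {Z'' : Matrix ι X ℝ} {t : ℝ}
    (hZ : ∀ j x, HasDerivAt (fun s => Z s j x) (Z' t j x) t)
    (hZ' : ∀ j x, HasDerivAt (fun s => Z' s j x) (Z'' j x) t) :
    HasDerivAt (fun s => frob (ceGrad y (Z s)) (Z' s))
      (ceHess (Z t) (Z' t) + frob (ceGrad y (Z t)) Z'') t := by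
  simp only [frob_ceGrad, ceHess, ← Finset.sum_add_distrib, ← add_sub_assoc]
  exact HasDerivAt.fun_sum fun x _ =>
    (hasDerivAt_dotProduct_softmax (z := fun s => (Z s).col x) (z' := fun s => (Z' s).col x)
      (fun j => hZ j x) fun j => hZ' j x).sub (hZ' (y x) x)

theorem iteratedDeriv_two_crossEntropy (y : X → ι) {Z Z' : ℝ → Matrix ι X ℝ} {Z'' : Matrix ι X ℝ}
    {t : ℝ} (hZ : ∀ s j x, HasDerivAt (fun s => Z s j x) (Z' s j x) s)
    (hZ' : ∀ j x, HasDerivAt (fun s => Z' s j x) (Z'' j x) t) :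
    iteratedDeriv 2 (fun s => crossEntropy y (Z s)) t
      = ceHess (Z t) (Z' t) + frob (ceGrad y (Z t)) Z'' := by
  have hderiv : deriv (fun s => crossEntropy y (Z s)) = fun s => frob (ceGrad y (Z s)) (Z' s) :=
    funext fun s => (hasDerivAt_crossEntropy y (hZ s)).deriv
  rw [iteratedDeriv_succ, iteratedDeriv_one, hderiv]
  exact (hasDerivAt_frob_ceGrad y (hZ t) hZ').deriv

end Gradient

end CrossEntropy

section Descent

open Filter Topology

variable {f : ℝ → ℝ} {x₀ : ℝ}

theorem eventually_lt_of_deriv_neg (hf : deriv f x₀ < 0) : ∀ᶠ t in 𝓝[>] x₀, f t < f x₀ := by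
  have hslope := (hasDerivAt_iff_tendsto_slope.1
    (differentiableAt_of_deriv_ne_zero hf.ne).hasDerivAt).eventually (gt_mem_nhds hf)
  filter_upwards [nhdsGT_le_nhdsNE x₀ hslope, self_mem_nhdsWithin] with t ht hxt
  rw [slope_def_field] at ht
  exact sub_neg.1 (neg_of_div_neg_left ht (sub_nonneg.2 (le_of_lt hxt)))

theorem eventually_lt_of_iteratedDeriv_two_neg (hc : ContinuousAt f x₀) (hf : deriv f x₀ = 0)
    (hf' : iteratedDeriv 2 f x₀ < 0) : ∀ᶠ t in 𝓝[>] x₀, f t < f x₀ := by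
  rw [iteratedDeriv_succ, iteratedDeriv_one] at hf'
  obtain ⟨b, hb, hneg⟩ := mem_nhdsGT_iff_exists_Ioo_subset.1 (eventually_lt_of_deriv_neg hf')
  have hderiv (s : ℝ) (hs : s ∈ Set.Ioo x₀ b) : deriv f s < 0 := hf ▸ hneg hs
  filter_upwards [Ioo_mem_nhdsGT hb] with t ht
  have hanti : StrictAntiOn f (Set.Icc x₀ t) := by
    refine strictAntiOn_of_deriv_neg (convex_Icc x₀ t) (fun s hs => ?_) fun s hs => ?_
    · rcases hs.1.eq_or_lt with rfl | hlt
      · exact hc.continuousWithinAt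
      · exact (differentiableAt_of_deriv_ne_zero
          (hderiv s ⟨hlt, hs.2.trans_lt ht.2⟩).ne).continuousAt.continuousWithinAt
    · rw [interior_Icc] at hs
      exact hderiv s ⟨hs.1, hs.2.trans ht.2⟩
  exact hanti (Set.left_mem_Icc.2 ht.1.le) (Set.right_mem_Icc.2 ht.1.le) ht.1

end Descent

section Curves

variable {ι X m : Type*} [Fintype m]

theorem hasDerivAt_mul_apply {A : ℝ → Matrix ι m ℝ} {B : ℝ → Matrix m X ℝ} {A' : Matrix ι m ℝ}
    {B' : Matrix m X ℝ} {t : ℝ} (hA : ∀ j a, HasDerivAt (fun s => A s j a) (A' j a) t)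
    (hB : ∀ a x, HasDerivAt (fun s => B s a x) (B' a x) t) (j : ι) (x : X) :
    HasDerivAt (fun s => (A s * B s) j x) ((A' * B t + A t * B') j x) t := by
  simp only [Matrix.mul_apply, Matrix.add_apply, ← Finset.sum_add_distrib]
  exact HasDerivAt.fun_sum fun a _ => (hA j a).mul (hB a x)

theorem hasDerivAt_smul_add_smul_apply {a b : ℝ → ℝ} {a' b' t : ℝ} (ha : HasDerivAt a a' t)
    (hb : HasDerivAt b b' t) (W V : Matrix ι X ℝ) (j : ι) (x : X) :
    HasDerivAt (fun s => (a s • W + b s • V) j x) ((a' • W + b' • V) j x) t :=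
  (ha.mul_const (W j x)).add (hb.mul_const (V j x))

variable [Fintype ι] [Fintype X] [DecidableEq ι]

/-- The second derivative at `(W, H)` of the loss `(W, H) ↦ crossEntropy y (W * H)` in the direction
`(V, F)`. -/
noncomputable def factorHess (y : X → ι) (W : Matrix ι m ℝ) (H : Matrix m X ℝ) (V : Matrix ι m ℝ)
    (F : Matrix m X ℝ) : ℝ :=
  2 * frob (ceGrad y (W * H)) (V * F) + ceHess (W * H) (V * H + W * F)

theorem factorHess_smul (y : X → ι) (W V : Matrix ι m ℝ) (H F : Matrix m X ℝ) (r : ℝ) :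
    factorHess y W H (r • V) (r • F) = r ^ 2 * factorHess y W H V F := by
  simp only [factorHess, Matrix.smul_mul, Matrix.mul_smul, ← smul_add, ceHess_smul, map_smul,
    smul_eq_mul]
  ring

variable [Nonempty ι] (y : X → ι)

theorem hasDerivAt_crossEntropy_mul {A : ℝ → Matrix ι m ℝ} {B : ℝ → Matrix m X ℝ}
    {A' : Matrix ι m ℝ} {B' : Matrix m X ℝ} {t : ℝ}
    (hA : ∀ j a, HasDerivAt (fun s => A s j a) (A' j a) t)
    (hB : ∀ a x, HasDerivAt (fun s => B s a x) (B' a x) t) :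
    HasDerivAt (fun s => crossEntropy y (A s * B s))
      (frob (ceGrad y (A t * B t)) (A' * B t + A t * B')) t :=
  hasDerivAt_crossEntropy y (hasDerivAt_mul_apply hA hB)

theorem iteratedDeriv_two_crossEntropy_mul {A A' : ℝ → Matrix ι m ℝ} {B B' : ℝ → Matrix m X ℝ}
    {A'' : Matrix ι m ℝ} {B'' : Matrix m X ℝ} {t : ℝ}
    (hA : ∀ s j a, HasDerivAt (fun s => A s j a) (A' s j a) s)
    (hB : ∀ s a x, HasDerivAt (fun s => B s a x) (B' s a x) s)
    (hA' : ∀ j a, HasDerivAt (fun s => A' s j a) (A'' j a) t)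
    (hB' : ∀ a x, HasDerivAt (fun s => B' s a x) (B'' a x) t) :
    iteratedDeriv 2 (fun s => crossEntropy y (A s * B s)) t
      = factorHess y (A t) (B t) (A' t) (B' t)
        + frob (ceGrad y (A t * B t)) (A'' * B t + A t * B'') := by
  rw [iteratedDeriv_two_crossEntropy y (Z' := fun s => A' s * B s + A s * B' s)
    (fun s => hasDerivAt_mul_apply (hA s) (hB s)) fun j x =>
      (hasDerivAt_mul_apply hA' (hB t) j x).add (hasDerivAt_mul_apply (hA t) hB' j x)]
  change _ + frob _ (A'' * B t + A' t * B' t + (A' t * B' t + A t * B'')) = _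
  simp only [factorHess, map_add]
  ring

variable (W V : Matrix ι m ℝ) (H F : Matrix m X ℝ)

theorem hasDerivAt_crossEntropy_line :
    HasDerivAt (fun t : ℝ => crossEntropy y ((W + t • V) * (H + t • F)))
      (frob (ceGrad y (W * H)) (V * H + W * F)) 0 := by
  have ha := hasDerivAt_const (0 : ℝ) (1 : ℝ)
  have hb := hasDerivAt_id (0 : ℝ)
  simpa using hasDerivAt_crossEntropy_mul y (hasDerivAt_smul_add_smul_apply ha hb W V)
    (hasDerivAt_smul_add_smul_apply ha hb H F)

theorem hasDerivAt_crossEntropy_circle :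
    HasDerivAt (fun t : ℝ => crossEntropy y
      ((Real.cos t • W + Real.sin t • V) * (Real.cos t • H + Real.sin t • F)))
      (frob (ceGrad y (W * H)) (V * H + W * F)) 0 := by
  have ha := Real.hasDerivAt_cos 0
  have hb := Real.hasDerivAt_sin 0
  simpa using hasDerivAt_crossEntropy_mul y (hasDerivAt_smul_add_smul_apply ha hb W V)
    (hasDerivAt_smul_add_smul_apply ha hb H F)

theorem iteratedDeriv_two_crossEntropy_line :
    iteratedDeriv 2 (fun t : ℝ => crossEntropy y ((W + t • V) * (H + t • F))) 0
      = factorHess y W H V F := by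
  have ha (s : ℝ) := hasDerivAt_const s (1 : ℝ)
  have hb (s : ℝ) := hasDerivAt_id s
  have ha' := hasDerivAt_const (0 : ℝ) (0 : ℝ)
  have hb' := hasDerivAt_const (0 : ℝ) (1 : ℝ)
  simpa using iteratedDeriv_two_crossEntropy_mul y
    (fun s => hasDerivAt_smul_add_smul_apply (ha s) (hb s) W V)
    (fun s => hasDerivAt_smul_add_smul_apply (ha s) (hb s) H F)
    (hasDerivAt_smul_add_smul_apply ha' hb' W V) (hasDerivAt_smul_add_smul_apply ha' hb' H F)

theorem iteratedDeriv_two_crossEntropy_circle :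
    iteratedDeriv 2 (fun t : ℝ => crossEntropy y
      ((Real.cos t • W + Real.sin t • V) * (Real.cos t • H + Real.sin t • F))) 0
      = factorHess y W H V F - 2 * frob (ceGrad y (W * H)) (W * H) := by
  have ha (s : ℝ) := Real.hasDerivAt_cos s
  have hb (s : ℝ) := Real.hasDerivAt_sin s
  have ha' := (Real.hasDerivAt_sin 0).neg
  have hb' := Real.hasDerivAt_cos 0
  have hcircle := iteratedDeriv_two_crossEntropy_mul y
    (fun s => hasDerivAt_smul_add_smul_apply (ha s) (hb s) W V)
    (fun s => hasDerivAt_smul_add_smul_apply (ha s) (hb s) H F)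
    (hasDerivAt_smul_add_smul_apply ha' hb' W V) (hasDerivAt_smul_add_smul_apply ha' hb' H F)
  simp only [Real.cos_zero, Real.sin_zero, neg_zero, one_smul, zero_smul, add_zero, zero_add,
    neg_smul, Matrix.neg_mul, Matrix.mul_neg, map_add, map_neg] at hcircle
  rw [hcircle]
  ring

end Curves

section LinearAlgebra

theorem dotProduct_self_nonneg {l : Type*} [Fintype l] (v : l → ℝ) : 0 ≤ v ⬝ᵥ v :=
  Finset.sum_nonneg fun _ _ => mul_self_nonneg _

theorem dotProduct_self_pos {l : Type*} [Fintype l] {v : l → ℝ} (hv : v ≠ 0) : 0 < v ⬝ᵥ v :=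
  (dotProduct_self_nonneg v).lt_of_ne' fun h => hv (dotProduct_self_eq_zero.1 h)

variable {ι X m : Type*} [Fintype ι] [Fintype m] [Nonempty ι]

theorem exists_dotProduct_one_eq_zero {G : Matrix ι X ℝ} (hG : 1 ᵥ* G = 0) (u : ι → ℝ) :
    ∃ v : ι → ℝ, v ⬝ᵥ 1 = 0 ∧ v ᵥ* G = u ᵥ* G ∧ v ⬝ᵥ v ≤ u ⬝ᵥ u := by
  set c : ℝ := (u ⬝ᵥ 1) / Fintype.card ι
  have hcard : (Fintype.card ι : ℝ) ≠ 0 := Nat.cast_ne_zero.2 Fintype.card_ne_zero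
  have hmean : (u - c • 1) ⬝ᵥ 1 = 0 := by
    rw [sub_dotProduct, smul_dotProduct, one_dotProduct_one, smul_eq_mul,
      div_mul_cancel₀ _ hcard, sub_self]
  refine ⟨u - c • 1, hmean, ?_, ?_⟩
  · rw [Matrix.sub_vecMul, Matrix.smul_vecMul, hG, smul_zero, sub_zero]
  · have hpyth : u ⬝ᵥ u = (u - c • 1) ⬝ᵥ (u - c • 1) + c ^ 2 * Fintype.card ι := by
      conv_lhs => rw [← sub_add_cancel u (c • 1)]
      simp only [add_dotProduct, dotProduct_add, dotProduct_smul, smul_dotProduct, hmean,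
        dotProduct_comm 1 (u - c • 1), one_dotProduct_one, smul_eq_mul]
      ring
    rw [hpyth]
    exact le_add_of_nonneg_right (by positivity)

theorem exists_mulVec_eq_smul_one (hcard : Fintype.card ι ≤ Fintype.card m + 1)
    (W : Matrix ι m ℝ) {u : ι → ℝ} (hu : ∀ a (c : ℝ), W *ᵥ a + c • 1 ≠ u) :
    ∃ a ≠ 0, ∃ c : ℝ, W *ᵥ a = c • 1 := by
  let T : (m → ℝ) × ℝ →ₗ[ℝ] ι → ℝ := W.mulVecLin.coprod (LinearMap.toSpanSingleton ℝ _ 1)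
  have hT (p : (m → ℝ) × ℝ) : T p = W *ᵥ p.1 + p.2 • 1 := rfl
  have hinj : ¬ Function.Injective T := fun hinj => by
    have hrank : Module.finrank ℝ ((m → ℝ) × ℝ) = Module.finrank ℝ (ι → ℝ) :=
      (LinearMap.finrank_le_finrank_of_injective hinj).antisymm (by simpa using hcard)
    obtain ⟨p, hp⟩ := (LinearMap.injective_iff_surjective_of_finrank_eq_finrank hrank).1 hinj u
    exact hu p.1 p.2 ((hT p).symm.trans hp)
  rw [← LinearMap.ker_eq_bot, Submodule.eq_bot_iff] at hinj
  push Not at hinj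
  obtain ⟨⟨a, c⟩, hker, hne⟩ := hinj
  have hsum : W *ᵥ a + c • 1 = 0 := hker
  refine ⟨a, fun ha => hne ?_, -c, by rw [neg_smul, eq_neg_of_add_eq_zero_left hsum]⟩
  rw [ha, Matrix.mulVec_zero, zero_add, smul_eq_zero_iff_left one_ne_zero] at hsum
  rw [ha, hsum, Prod.mk_zero_zero]

end LinearAlgebra

section Multiplier

variable {ι X m : Type*} [Fintype ι] [Fintype X] [Fintype m] [DecidableEq ι]

/-- `(W, H)` satisfies the Lagrange condition with multiplier `lam`: the gradient of the loss
`(W, H) ↦ crossEntropy y (W * H)` is `-lam` times `(W, H)`. -/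
structure HasMultiplier (y : X → ι) (W : Matrix ι m ℝ) (H : Matrix m X ℝ) (lam : ℝ) : Prop where
  grad_left : ceGrad y (W * H) * Hᵀ = -lam • W
  grad_right : Wᵀ * ceGrad y (W * H) = -lam • H

variable {y : X → ι} {W : Matrix ι m ℝ} {H : Matrix m X ℝ} {lam : ℝ}

theorem exists_hasMultiplier (hcrit : ∀ V F, frob W V + frob H F = 0 →
      frob (ceGrad y (W * H)) (V * H + W * F) = 0) :
    ∃ lam, HasMultiplier y W H lam ∧ (lam ≠ 0 → (W, H) ≠ 0) := by
  by_cases h0 : (W, H) = 0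
  · obtain ⟨rfl, rfl⟩ := Prod.mk.inj h0
    exact ⟨0, ⟨by simp, by simp⟩, fun h => absurd rfl h⟩
  set G := ceGrad y (W * H)
  have hgrad (V : Matrix ι m ℝ) (F : Matrix m X ℝ) :
      ((frob (G * Hᵀ)).coprod (frob (Wᵀ * G))) (V, F) = frob G (V * H + W * F) := by
    rw [LinearMap.coprod_apply, frob_mul_transpose_left, frob_transpose_mul_left, map_add]
  have hker : ⨅ _ : Unit, LinearMap.ker ((frob W).coprod (frob H))
      ≤ LinearMap.ker ((frob (G * Hᵀ)).coprod (frob (Wᵀ * G))) := by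
    rw [ciInf_const]
    rintro ⟨V, F⟩ hVF
    rw [LinearMap.mem_ker, hgrad]
    exact hcrit V F hVF
  obtain ⟨c, hc⟩ : ∃ c : ℝ, c • (frob W).coprod (frob H)
      = (frob (G * Hᵀ)).coprod (frob (Wᵀ * G)) := by
    simpa [Submodule.mem_span_singleton] using mem_span_of_iInf_ker_le_ker hker
  refine ⟨-c, ⟨eq_of_frob_eq fun V => ?_, eq_of_frob_eq fun F => ?_⟩, fun _ => h0⟩
  · simpa using (LinearMap.congr_fun hc (V, 0)).symm
  · simpa using (LinearMap.congr_fun hc (0, F)).symm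

namespace HasMultiplier

variable (h : HasMultiplier y W H lam)
include h

theorem frob_ceGrad_mul_eq_left : frob (ceGrad y (W * H)) (W * H) = -lam * frob W W := by
  rw [← frob_mul_transpose_left, h.grad_left, map_smul, LinearMap.smul_apply, smul_eq_mul]

theorem frob_ceGrad_mul_eq_right : frob (ceGrad y (W * H)) (W * H) = -lam * frob H H := by
  rw [← frob_transpose_mul_left, h.grad_right, map_smul, LinearMap.smul_apply, smul_eq_mul]

theorem frob_self_eq (hlam : lam ≠ 0) : frob W W = frob H H :=
  mul_left_cancel₀ (neg_ne_zero.2 hlam)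
    (h.frob_ceGrad_mul_eq_left.symm.trans h.frob_ceGrad_mul_eq_right)

theorem frob_self_pos (hlam : lam ≠ 0) (h0 : (W, H) ≠ 0) : 0 < frob W W := by
  refine (frob_self_nonneg W).lt_of_ne' fun hW => h0 ?_
  rw [frob_self_eq_zero.1 hW, frob_self_eq_zero.1 ((h.frob_self_eq hlam).symm.trans hW),
    Prod.mk_zero_zero]

theorem norm_eq (hlam : lam ≠ 0) : ‖W‖ = ‖H‖ := by
  rw [← sq_eq_sq₀ (norm_nonneg W) (norm_nonneg H), ← frob_self, ← frob_self, h.frob_self_eq hlam]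

theorem smul_transpose_mul_self : lam • (Wᵀ * W) = lam • (H * Hᵀ) := by
  have hassoc := Matrix.mul_assoc Wᵀ (ceGrad y (W * H)) Hᵀ
  rw [h.grad_left, h.grad_right, Matrix.smul_mul, Matrix.mul_smul, neg_smul, neg_smul,
    neg_inj] at hassoc
  exact hassoc.symm

theorem mul_dotProduct_vecMul_self (a : m → ℝ) :
    lam * ((a ᵥ* H) ⬝ᵥ (a ᵥ* H)) = lam * ((W *ᵥ a) ⬝ᵥ (W *ᵥ a)) := by
  have hgram := congrArg (fun M : Matrix m m ℝ => a ⬝ᵥ M *ᵥ a) h.smul_transpose_mul_self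
  simp only [Matrix.smul_mulVec, dotProduct_smul, smul_eq_mul] at hgram
  rw [← Matrix.dotProduct_mulVec, Matrix.mulVec_vecMul, ← hgram, Matrix.dotProduct_mulVec,
    Matrix.dotProduct_mulVec, ← Matrix.vecMul_mulVec]

theorem vecMul_ceGrad_mulVec (a : m → ℝ) :
    (W *ᵥ a) ᵥ* ceGrad y (W * H) = -lam • (a ᵥ* H) := by
  rw [Matrix.vecMul_mulVec, h.grad_right, Matrix.vecMul_smul]

theorem dotProduct_vecMul_ceGrad (u : ι → ℝ) (a : m → ℝ) :
    (a ᵥ* H) ⬝ᵥ (u ᵥ* ceGrad y (W * H)) = -lam * (u ⬝ᵥ W *ᵥ a) := by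
  rw [dotProduct_comm, ← Matrix.dotProduct_mulVec, Matrix.mulVec_vecMul, h.grad_left,
    Matrix.smul_mulVec, dotProduct_smul, smul_eq_mul]

variable [Nonempty ι]

theorem mul_dotProduct_one (a : m → ℝ) : lam * ((W *ᵥ a) ⬝ᵥ 1) = 0 := by
  have hcol := h.dotProduct_vecMul_ceGrad 1 a
  rw [one_vecMul_ceGrad, dotProduct_zero, dotProduct_comm] at hcol
  linarith

theorem dotProduct_vecMul_ceGrad_self_le (a : m → ℝ) (c : ℝ) :
    ((W *ᵥ a + c • 1) ᵥ* ceGrad y (W * H)) ⬝ᵥ ((W *ᵥ a + c • 1) ᵥ* ceGrad y (W * H))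
      ≤ lam ^ 2 * ((W *ᵥ a + c • 1) ⬝ᵥ (W *ᵥ a + c • 1)) := by
  rw [Matrix.add_vecMul, Matrix.smul_vecMul, one_vecMul_ceGrad, smul_zero, add_zero,
    h.vecMul_ceGrad_mulVec]
  simp only [dotProduct_smul, smul_dotProduct, add_dotProduct, dotProduct_add, smul_eq_mul,
    dotProduct_comm 1 (W *ᵥ a), one_dotProduct_one]
  have hsq : 0 ≤ (lam * c) ^ 2 * Fintype.card ι := by positivity
  linear_combination lam * h.mul_dotProduct_vecMul_self a + hsq
    - 2 * lam * c * h.mul_dotProduct_one a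

end HasMultiplier

end Multiplier

section NegativeCurvature

theorem exists_quadratic_neg {lam A S U q : ℝ} (hA : 0 < A) (hlam : 0 ≤ lam)
    (hS : lam ^ 2 * U < S) (hq : 0 < lam → q = 0) :
    ∃ s : ℝ, q - 2 * s * A * S + lam * (U * A + s ^ 2 * (A * S)) < 0 := by
  rcases hlam.eq_or_lt with rfl | hpos
  · have hS' : 0 < S := by linarith
    refine ⟨(q + 1) / (2 * (A * S)), ?_⟩
    have hs : (q + 1) / (2 * (A * S)) * (2 * (A * S)) = q + 1 :=
      div_mul_cancel₀ _ (by positivity)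
    linarith
  · refine ⟨1 / lam, ?_⟩
    have hvalue : q - 2 * (1 / lam) * A * S + lam * (U * A + (1 / lam) ^ 2 * (A * S))
        = A * (lam ^ 2 * U - S) / lam := by
      rw [hq hpos]
      field_simp
      ring
    rw [hvalue]
    exact div_neg_of_neg_of_pos (mul_neg_of_pos_of_neg hA (sub_neg.2 hS)) hpos

variable {ι X m : Type*} [Fintype ι] [Fintype X] [Fintype m] [DecidableEq ι]
variable {y : X → ι} {W : Matrix ι m ℝ} {H : Matrix m X ℝ} {lam : ℝ}

namespace HasMultiplier

theorem factorHess_neg_right (h : HasMultiplier y W H lam) :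
    factorHess y W H W (-H) = 2 * lam * frob W W := by
  rw [factorHess, Matrix.mul_neg, add_neg_cancel, ceHess_zero, map_neg, h.frob_ceGrad_mul_eq_left]
  ring

theorem frob_vecMulVec_add_eq_zero (h : HasMultiplier y W H lam) {a : m → ℝ} {c : ℝ}
    (ha : W *ᵥ a = c • 1) {u : ι → ℝ} (hu : u ⬝ᵥ 1 = 0) (s : ℝ) :
    frob W (Matrix.vecMulVec u a)
      + frob H (-s • Matrix.vecMulVec a (u ᵥ* ceGrad y (W * H))) = 0 := by
  have hua : u ⬝ᵥ W *ᵥ a = 0 := by rw [ha, dotProduct_smul, hu, smul_zero]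
  rw [map_smul, frob_vecMulVec_right, frob_vecMulVec_right, h.dotProduct_vecMul_ceGrad,
    ← Matrix.dotProduct_mulVec, hua, mul_zero, smul_zero, add_zero]

end HasMultiplier

variable [Nonempty ι]

theorem factorHess_vecMulVec (y : X → ι) (H : Matrix m X ℝ) {a : m → ℝ} {c : ℝ}
    (ha : W *ᵥ a = c • 1) (u : ι → ℝ) (s : ℝ) :
    factorHess y W H (Matrix.vecMulVec u a)
        (-s • Matrix.vecMulVec a (u ᵥ* ceGrad y (W * H)))
      = ceHess (W * H) (Matrix.vecMulVec u (a ᵥ* H))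
        - 2 * s * (a ⬝ᵥ a) * ((u ᵥ* ceGrad y (W * H)) ⬝ᵥ (u ᵥ* ceGrad y (W * H))) := by
  set g := u ᵥ* ceGrad y (W * H) with hg
  have hgrad : frob (ceGrad y (W * H)) (Matrix.vecMulVec u a * -s • Matrix.vecMulVec a g)
      = -s * ((a ⬝ᵥ a) * (g ⬝ᵥ g)) := by
    rw [Matrix.mul_smul, Matrix.vecMulVec_mul_vecMulVec, map_smul, smul_eq_mul,
      frob_vecMulVec_right, ← hg, dotProduct_smul, smul_eq_mul]
  have hcol : W * -s • Matrix.vecMulVec a g = Matrix.vecMulVec 1 ((-s * c) • g) := by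
    rw [Matrix.mul_smul, Matrix.mul_vecMulVec, ha, Matrix.smul_vecMulVec, Matrix.vecMulVec_smul,
      smul_smul]
  rw [factorHess, hgrad, hcol, Matrix.vecMulVec_mul, ceHess_add_vecMulVec_one]
  ring

theorem HasMultiplier.vecMul_eq_zero (h : HasMultiplier y W H lam) (hlam : lam ≠ 0)
    {a : m → ℝ} {c : ℝ} (ha : W *ᵥ a = c • 1) : a ᵥ* H = 0 := by
  have hone := h.mul_dotProduct_one a
  rw [ha, smul_dotProduct, one_dotProduct_one, smul_eq_mul] at hone
  have hc : c = 0 := by simpa [hlam] using hone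
  have hnorm := h.mul_dotProduct_vecMul_self a
  rw [ha, hc, zero_smul, zero_dotProduct, mul_zero] at hnorm
  exact dotProduct_self_eq_zero.1 ((mul_eq_zero_iff_left hlam).1 hnorm)

theorem HasMultiplier.exists_neg_of_lt (h : HasMultiplier y W H lam)
    (hcard : Fintype.card ι ≤ Fintype.card m + 1) (hlam : 0 ≤ lam) {u : ι → ℝ}
    (hu : lam ^ 2 * (u ⬝ᵥ u)
      < (u ᵥ* ceGrad y (W * H)) ⬝ᵥ (u ᵥ* ceGrad y (W * H))) :
    ∃ V F, frob W V + frob H F = 0 ∧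
      factorHess y W H V F + lam * (frob V V + frob F F) < 0 := by
  obtain ⟨v, hv, hvG, hle⟩ := exists_dotProduct_one_eq_zero (one_vecMul_ceGrad y (W * H)) u
  rw [← hvG] at hu
  have hv_lt := (mul_le_mul_of_nonneg_left hle (sq_nonneg lam)).trans_lt hu
  obtain ⟨a, ha0, c, ha⟩ := exists_mulVec_eq_smul_one hcard W (u := v) fun a c hac =>
    (hac ▸ h.dotProduct_vecMul_ceGrad_self_le a c).not_gt hv_lt
  obtain ⟨s, hs⟩ := exists_quadratic_neg (q := ceHess (W * H) (Matrix.vecMulVec v (a ᵥ* H)))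
    (dotProduct_self_pos ha0) hlam hv_lt fun hpos => by
      have hzero : Matrix.vecMulVec v (0 : X → ℝ) = 0 := Matrix.ext fun _ _ => mul_zero _
      rw [h.vecMul_eq_zero hpos.ne' ha, hzero, ceHess_zero]
  refine ⟨Matrix.vecMulVec v a, -s • Matrix.vecMulVec a (v ᵥ* ceGrad y (W * H)),
    h.frob_vecMulVec_add_eq_zero ha hv s, ?_⟩
  simpa only [factorHess_vecMulVec y H ha, map_smul, LinearMap.smul_apply, frob_vecMulVec_self,
    smul_eq_mul, neg_mul, mul_neg, neg_neg, ← mul_assoc, sq] using hs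

end NegativeCurvature

section Symmetry

variable {ι X m : Type*} [Fintype ι] [Fintype X] [Fintype m]

theorem frob_transpose_mul_self_le {G : Matrix ι X ℝ} {c : ℝ}
    (hG : ∀ u, (u ᵥ* G) ⬝ᵥ (u ᵥ* G) ≤ c * (u ⬝ᵥ u)) (V : Matrix ι m ℝ) :
    frob (Vᵀ * G) (Vᵀ * G) ≤ c * frob V V := by
  rw [frob_eq_sum, Finset.sum_comm, frob_eq_sum, Finset.mul_sum]
  exact Finset.sum_le_sum fun b _ => hG (V.col b)

theorem neg_mul_add_le_two_mul_frob {G : Matrix ι X ℝ} {lam : ℝ} (hlam : 0 < lam)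
    (hG : ∀ u, (u ᵥ* G) ⬝ᵥ (u ᵥ* G) ≤ lam ^ 2 * (u ⬝ᵥ u))
    (V : Matrix ι m ℝ) (F : Matrix m X ℝ) :
    -(lam * (frob V V + frob F F)) ≤ 2 * frob G (V * F) := by
  have hsq := frob_self_nonneg (Vᵀ * G + lam • F)
  simp only [map_add, map_smul, LinearMap.add_apply, LinearMap.smul_apply, smul_eq_mul,
    frob_comm F, frob_transpose_mul_left V G F] at hsq
  refine neg_le_iff_add_nonneg'.2 (nonneg_of_mul_nonneg_right ?_ hlam)
  linear_combination hsq + frob_transpose_mul_self_le hG V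

variable [DecidableEq ι]

theorem ne_zero_of_vecMul_ceGrad_le [Nontrivial ι] [Nonempty X] {y : X → ι} {Z : Matrix ι X ℝ}
    {lam : ℝ}
    (hop : ∀ u, (u ᵥ* ceGrad y Z) ⬝ᵥ (u ᵥ* ceGrad y Z) ≤ lam ^ 2 * (u ⬝ᵥ u)) : lam ≠ 0 := by
  rintro rfl
  refine ceGrad_ne_zero y Z (Matrix.ext_of_single_vecMul fun j => ?_)
  rw [Matrix.vecMul_zero]
  refine dotProduct_self_eq_zero.1 (le_antisymm ((hop _).trans_eq ?_) (dotProduct_self_nonneg _))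
  rw [zero_pow two_ne_zero, zero_mul]

variable {y : X → ι} {W : Matrix ι m ℝ} {H : Matrix m X ℝ} {lam : ℝ}

namespace HasMultiplier

variable [Nonempty ι]

theorem one_vecMul_eq_zero (h : HasMultiplier y W H lam) (hlam : lam ≠ 0) : 1 ᵥ* W = 0 := by
  have hW : 1 ᵥ* (-lam • W) = 0 := by
    rw [← h.grad_left, ← Matrix.vecMul_vecMul, one_vecMul_ceGrad, Matrix.zero_vecMul]
  rwa [Matrix.vecMul_smul, smul_eq_zero_iff_right (neg_ne_zero.2 hlam)] at hW

theorem submatrix_mul_eq (h : HasMultiplier y W H lam) (hlam : 0 < lam)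
    (hop : ∀ u, (u ᵥ* ceGrad y (W * H)) ⬝ᵥ (u ᵥ* ceGrad y (W * H)) ≤ lam ^ 2 * (u ⬝ᵥ u))
    {σ : Equiv.Perm ι} {ρ : Equiv.Perm X} (hσρ : ∀ x, y (ρ x) = σ (y x)) :
    (W * H).submatrix σ ρ = W * H := by
  have hgrad : 0 ≤ frob (ceGrad y (W * H)) ((W * H).submatrix σ ρ - W * H) := by
    have hle := neg_mul_add_le_two_mul_frob hlam hop (W.submatrix σ (Equiv.refl m))
      (H.submatrix (Equiv.refl m) ρ)
    rw [Matrix.submatrix_mul_equiv, frob_submatrix, frob_submatrix] at hle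
    rw [map_sub]
    linarith [h.frob_ceGrad_mul_eq_left, h.frob_ceGrad_mul_eq_right]
  obtain ⟨v, hv⟩ := exists_sub_eq_vecMulVec_one_of_crossEntropy_le
    (crossEntropy_submatrix hσρ (W * H)).le hgrad
  have hcol : 1 ᵥ* (W * H) = 0 := by
    rw [← Matrix.vecMul_vecMul, h.one_vecMul_eq_zero hlam.ne', Matrix.zero_vecMul]
  have hcol' : 1 ᵥ* (W * H).submatrix σ ρ = 0 := by
    rw [Matrix.submatrix_vecMul_equiv, Pi.one_comp, hcol, Pi.zero_comp]
  have hv0 : v = 0 := by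
    have hsum := congrArg (1 ᵥ* ·) hv
    simp only [Matrix.vecMul_sub, hcol, hcol', sub_zero, Matrix.vecMul_vecMulVec,
      one_dotProduct_one] at hsum
    exact (smul_eq_zero_iff_right (Nat.cast_ne_zero.2 Fintype.card_ne_zero)).1 hsum.symm
  refine sub_eq_zero.1 (hv.trans (Matrix.ext fun _ _ => ?_))
  rw [hv0]
  exact mul_zero _

end HasMultiplier

end Symmetry

section Simplex

variable {ι κ m : Type*} [Fintype ι] [DecidableEq ι]

variable (ι) in
/-- The Gram matrix of a simplex equiangular tight frame indexed by `ι`, normalised to have integer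
entries: `card ι - 1` on the diagonal and `-1` elsewhere. -/
def simplexGram : Matrix ι ι ℝ :=
  Matrix.of fun j k => (if j = k then (Fintype.card ι : ℝ) else 0) - 1

theorem simplexGram_self (k : ι) : simplexGram ι k k = Fintype.card ι - 1 := by
  simp [simplexGram]

theorem simplexGram_of_ne {j k : ι} (hjk : j ≠ k) : simplexGram ι j k = -1 := by
  simp [simplexGram, hjk]

theorem simplexGram_self_pos [Nontrivial ι] (k : ι) : 0 < simplexGram ι k k := by
  rw [simplexGram_self, sub_pos]
  exact_mod_cast Fintype.one_lt_card

theorem transpose_mul_simplexGram {W : Matrix ι m ℝ} (hW : 1 ᵥ* W = 0) :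
    Wᵀ * simplexGram ι = (Fintype.card ι : ℝ) • Wᵀ := by
  ext b k
  have hb : ∑ j, W j b = 0 := by simpa [Matrix.vecMul, dotProduct] using congrFun hW b
  simp [Matrix.mul_apply, simplexGram, mul_sub, Finset.sum_sub_distrib, hb, mul_comm]

theorem exists_eq_smul_simplexGram [Nontrivial ι] [Nonempty κ] {M : Matrix ι (ι × κ) ℝ}
    (hM : 1 ᵥ* M = 0)
    (hsymm : ∀ (σ : Equiv.Perm ι) (τ : Equiv.Perm κ), M.submatrix σ (σ.prodCongr τ) = M) :
    ∃ c : ℝ, M = c • (simplexGram ι).submatrix id Prod.fst := by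
  classical
  have hentry (σ : Equiv.Perm ι) (τ : Equiv.Perm κ) (j k i) : M (σ j) (σ k, τ i) = M j (k, i) :=
    congrFun₂ (hsymm σ τ) j (k, i)
  obtain ⟨k₀⟩ := ‹Nontrivial ι›.to_nonempty
  obtain ⟨i₀⟩ := ‹Nonempty κ›
  have hdiag (k i) : M k (k, i) = M k₀ (k₀, i₀) := by
    simpa using (hentry (Equiv.swap k k₀) (Equiv.swap i i₀) k k i).symm
  have hcard : (Fintype.card ι : ℝ) - 1 ≠ 0 := simplexGram_self k₀ ▸ (simplexGram_self_pos k₀).ne'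
  refine ⟨M k₀ (k₀, i₀) / (Fintype.card ι - 1), Matrix.ext fun j ⟨k, i⟩ => ?_⟩
  rw [Matrix.smul_apply, Matrix.submatrix_apply, id, smul_eq_mul]
  obtain rfl | hjk := eq_or_ne j k
  · rw [simplexGram_self, hdiag, div_mul_cancel₀ _ hcard]
  · have hoff : ∀ j' ∈ Finset.univ.erase k, M j' (k, i) = M j (k, i) := fun j' hj' => by
      simpa [Equiv.swap_apply_of_ne_of_ne (Finset.ne_of_mem_erase hj').symm hjk.symm] using
        (hentry (Equiv.swap j' j) 1 j' k i).symm
    have hsum : ∑ j', M j' (k, i) = 0 := by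
      simpa [Matrix.vecMul, dotProduct] using congrFun hM (k, i)
    rw [← Finset.add_sum_erase _ _ (Finset.mem_univ k), Finset.sum_congr rfl hoff, hdiag,
      Finset.sum_const, Finset.card_erase_of_mem (Finset.mem_univ k), Finset.card_univ,
      nsmul_eq_mul, Nat.cast_sub Fintype.card_pos, Nat.cast_one] at hsum
    rw [simplexGram_of_ne hjk]
    field_simp
    linarith

variable [Fintype m] [Nontrivial ι] [Nonempty κ] {W : Matrix ι m ℝ}

theorem exists_mul_transpose_eq_smul_simplexGram {r : ℝ} (hr : 0 < r) (hW0 : W ≠ 0)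
    (hW : 1 ᵥ* W = 0)
    (hsymm : ∀ (σ : Equiv.Perm ι) (τ : Equiv.Perm κ),
      (W * r • Wᵀ.submatrix id Prod.fst : Matrix ι (ι × κ) ℝ).submatrix σ (σ.prodCongr τ)
        = W * r • Wᵀ.submatrix id Prod.fst) :
    ∃ c : ℝ, 0 < c ∧ W * Wᵀ = c • simplexGram ι := by
  obtain ⟨c, hc⟩ := exists_eq_smul_simplexGram
    (by rw [← Matrix.vecMul_vecMul, hW, Matrix.zero_vecMul]) hsymm
  obtain ⟨i⟩ := ‹Nonempty κ›
  have hgram : W * Wᵀ = (r⁻¹ * c) • simplexGram ι := by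
    ext j k
    have hjk := congrFun₂ hc j (k, i)
    rw [Matrix.mul_smul] at hjk
    rw [Matrix.smul_apply, mul_smul, eq_inv_smul_iff₀ hr.ne']
    exact hjk
  obtain ⟨k, hk⟩ : ∃ k, W k ≠ 0 := Function.ne_iff.1 hW0
  have hkk : (r⁻¹ * c) * simplexGram ι k k = W k ⬝ᵥ W k := (congrFun₂ hgram k k).symm
  exact ⟨r⁻¹ * c, pos_of_mul_pos_left (hkk ▸ dotProduct_self_pos hk) (simplexGram_self_pos k).le,
    hgram⟩

theorem exists_ceGrad_eq_smul_simplexGram {Z : Matrix ι (ι × κ) ℝ}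
    (hZ : ∀ (σ : Equiv.Perm ι) (τ : Equiv.Perm κ), Z.submatrix σ (σ.prodCongr τ) = Z) :
    ∃ g : ℝ, g < 0 ∧ ceGrad Prod.fst Z = g • (simplexGram ι).submatrix id Prod.fst := by
  obtain ⟨g, hg⟩ := exists_eq_smul_simplexGram (one_vecMul_ceGrad Prod.fst Z) fun σ τ =>
    (ceGrad_submatrix (σ := σ) (ρ := σ.prodCongr τ) (fun _ => rfl) Z).symm.trans
      (congrArg (ceGrad Prod.fst) (hZ σ τ))
  obtain ⟨j, k, hjk⟩ := exists_pair_ne ι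
  obtain ⟨i⟩ := ‹Nonempty κ›
  have hjki : softmax (Z.col (k, i)) j = -g := by
    simpa [ceGrad, hjk, simplexGram_of_ne hjk] using congrFun₂ hg j (k, i)
  exact ⟨g, neg_pos.1 (hjki ▸ softmax_pos _ j), hg⟩

variable [Fintype κ] {H : Matrix m (ι × κ) ℝ} {lam : ℝ}

theorem HasMultiplier.exists_eq_smul_transpose (h : HasMultiplier Prod.fst W H lam)
    (hlam : 0 < lam)
    (hsymm : ∀ (σ : Equiv.Perm ι) (τ : Equiv.Perm κ),
      (W * H).submatrix σ (σ.prodCongr τ) = W * H) :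
    ∃ r : ℝ, 0 < r ∧ H = r • Wᵀ.submatrix id Prod.fst := by
  obtain ⟨g, hg, hG⟩ := exists_ceGrad_eq_smul_simplexGram hsymm
  have hcard : (0 : ℝ) < Fintype.card ι := Nat.cast_pos.2 Fintype.card_pos
  have hH : -lam • H = (g * Fintype.card ι) • Wᵀ.submatrix id Prod.fst := by
    have hS := congrArg (fun A => A.submatrix id (Prod.fst : ι × κ → ι))
      (transpose_mul_simplexGram (h.one_vecMul_eq_zero hlam.ne'))
    rw [← h.grad_right, hG, Matrix.mul_smul, mul_smul]
    exact congrArg (g • ·) hS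
  refine ⟨-lam⁻¹ * (g * Fintype.card ι), mul_pos_of_neg_of_neg (neg_neg_of_pos (inv_pos.2 hlam))
    (mul_neg_of_neg_of_pos hg hcard), ?_⟩
  rw [mul_smul, ← hH, smul_smul, neg_mul_neg, inv_mul_cancel₀ hlam.ne', one_smul]

end Simplex

section NeuralCollapse

variable {K n d : ℕ} {W : Classifiers K d} {H : Features K n d}

theorem isNeuralCollapse_of_classMean_eq {r c : ℝ} (hr : 0 < r) (hc : 0 < c) (hK : 2 ≤ K)
    (hfeature : ∀ k i, feature H k i = classMean H k)
    (hmean : ∀ k, classMean H k = r • classifier W k)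
    (hinner : ∀ j k, inner ℝ (classifier W j) (classifier W k) = c * simplexGram (Fin K) j k) :
    IsNeuralCollapse W H := by
  have hK' : (0 : ℝ) < K - 1 := sub_pos.2 (Nat.one_lt_cast.2 hK)
  have hnorm_sq (k) : ‖classifier W k‖ ^ 2 = c * (K - 1) := by
    rw [← real_inner_self_eq_norm_sq, hinner, simplexGram_self, Fintype.card_fin]
  have hnorm (j k) : ‖classifier W j‖ = ‖classifier W k‖ :=
    (sq_eq_sq₀ (norm_nonneg _) (norm_nonneg _)).1 ((hnorm_sq j).trans (hnorm_sq k).symm)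
  refine ⟨fun k i => ?_, fun k j hkj => ⟨?_, ?_⟩, ⟨r⁻¹, inv_pos.2 hr, fun k => ?_⟩,
    fun h k => forall_congr' fun j => ?_⟩
  · rw [hfeature, sub_self, norm_zero]
  · rw [hmean, hmean, InnerProductGeometry.angle_smul_left_of_pos _ _ hr,
      InnerProductGeometry.angle_smul_right_of_pos _ _ hr, InnerProductGeometry.cos_angle, hinner,
      simplexGram_of_ne hkj, hnorm j k, ← sq, hnorm_sq]
    field_simp
  · rw [hmean, hmean, norm_smul, norm_smul, hnorm k j]
  · rw [hmean, smul_smul, inv_mul_cancel₀ hr.ne', one_smul]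
  · rw [← sq_le_sq₀ (norm_nonneg _) (norm_nonneg _), hmean, hmean, norm_sub_sq_real,
      norm_sub_sq_real, norm_smul, norm_smul, hnorm j k, inner_smul_right, inner_smul_right,
      real_inner_comm h, real_inner_comm h, add_le_add_iff_right, sub_le_sub_iff_left,
      mul_le_mul_iff_right₀ two_pos, mul_le_mul_iff_right₀ hr]

theorem isNeuralCollapse_of_eq_smul_transpose {r c : ℝ} (hr : 0 < r) (hc : 0 < c) (hK : 2 ≤ K)
    (hn : 1 ≤ n) (hH : H = r • Wᵀ.submatrix id Prod.fst)
    (hW : W * Wᵀ = c • simplexGram (Fin K)) :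
    IsNeuralCollapse W H := by
  have hfeature (k i) : feature H k i = r • classifier W k := by
    rw [hH]
    rfl
  have hmean (k) : classMean H k = r • classifier W k := by
    have hn' : (n : ℝ) ≠ 0 := Nat.cast_ne_zero.2 (Nat.one_le_iff_ne_zero.1 hn)
    simp only [classMean, hfeature, Finset.sum_const, Finset.card_univ, Fintype.card_fin]
    rw [← Nat.cast_smul_eq_nsmul ℝ, inv_smul_smul₀ hn']
  refine isNeuralCollapse_of_classMean_eq hr hc hK
    (fun k i => (hfeature k i).trans (hmean k).symm) hmean fun j k => ?_
  rw [real_inner_comm]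
  exact congrFun₂ hW j k

theorem HasMultiplier.isNeuralCollapse {lam : ℝ} (h : HasMultiplier Prod.fst W H lam) (hK : 2 ≤ K)
    (hn : 1 ≤ n) (hlam : 0 < lam) (hW0 : W ≠ 0)
    (hop : ∀ u, (u ᵥ* ceGrad Prod.fst (W * H)) ⬝ᵥ (u ᵥ* ceGrad Prod.fst (W * H))
      ≤ lam ^ 2 * (u ⬝ᵥ u)) :
    IsNeuralCollapse W H := by
  have : Nontrivial (Fin K) := Fin.nontrivial_iff_two_le.2 hK
  have : Nonempty (Fin n) := Fin.pos_iff_nonempty.1 hn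
  have hsymm (σ : Equiv.Perm (Fin K)) (τ : Equiv.Perm (Fin n)) :
      (W * H).submatrix σ (σ.prodCongr τ) = W * H :=
    h.submatrix_mul_eq hlam hop fun _ => rfl
  obtain ⟨r, hr, hH⟩ := h.exists_eq_smul_transpose hlam hsymm
  obtain ⟨c, hc, hW⟩ := exists_mul_transpose_eq_smul_simplexGram hr hW0
    (h.one_vecMul_eq_zero hlam.ne') (hH ▸ hsymm)
  exact isNeuralCollapse_of_eq_smul_transpose hr hc hK hn hH hW

end NeuralCollapse

section StrictSaddle

variable {K n d : ℕ} {W V : Classifiers K d} {H F : Features K n d}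

theorem HasMultiplier.exists_negative_direction {lam : ℝ} (h : HasMultiplier Prod.fst W H lam)
    (h0 : lam ≠ 0 → (W, H) ≠ 0) (hK : 2 ≤ K) (hn : 1 ≤ n) (hd : K ≤ d + 1)
    (hWH : ¬ IsNeuralCollapse W H ∨ ‖W‖ ≠ ‖H‖) :
    ∃ V F, frob W V + frob H F = 0 ∧ factorHess Prod.fst W H V F < 0 ∧
      factorHess Prod.fst W H V F + lam * (frob V V + frob F F) < 0 := by
  rcases lt_or_ge lam 0 with hneg | hlam
  · have hpos := h.frob_self_pos hneg.ne (h0 hneg.ne)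
    have hlt : lam * frob W W < 0 := mul_neg_of_neg_of_pos hneg hpos
    refine ⟨W, -H, ?_, ?_, ?_⟩
    · rw [map_neg, h.frob_self_eq hneg.ne, add_neg_cancel]
    · rw [h.factorHess_neg_right]
      linarith
    · rw [h.factorHess_neg_right, map_neg, map_neg frob, LinearMap.neg_apply, neg_neg,
        ← h.frob_self_eq hneg.ne]
      linarith
  · obtain ⟨u, hu⟩ : ∃ u, lam ^ 2 * (u ⬝ᵥ u)
        < (u ᵥ* ceGrad Prod.fst (W * H)) ⬝ᵥ (u ᵥ* ceGrad Prod.fst (W * H)) := by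
      by_contra! hop
      have : Nontrivial (Fin K) := Fin.nontrivial_iff_two_le.2 hK
      have : Nonempty (Fin n) := Fin.pos_iff_nonempty.1 hn
      have hpos := hlam.lt_of_ne' (ne_zero_of_vecMul_ceGrad_le hop)
      have hW0 : W ≠ 0 := fun hW => (h.frob_self_pos hpos.ne' (h0 hpos.ne')).ne' (by simp [hW])
      exact hWH.elim (· (h.isNeuralCollapse hK hn hpos hW0 hop)) (· (h.norm_eq hpos.ne'))
    have : NeZero K := ⟨by lia⟩
    obtain ⟨V, F, hT, hneg⟩ := h.exists_neg_of_lt (by simpa using hd) hlam hu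
    refine ⟨V, F, hT, lt_of_le_of_lt (le_add_of_nonneg_right ?_) hneg, hneg⟩
    exact mul_nonneg hlam (add_nonneg (frob_self_nonneg V) (frob_self_nonneg F))

end StrictSaddle

section LossCurves

variable {K n d : ℕ} [NeZero K] (W V : Classifiers K d) (H F : Features K n d)

theorem hasDerivAt_loss_line :
    HasDerivAt (fun t : ℝ => loss (W + t • V) (H + t • F))
      (frob (ceGrad Prod.fst (W * H)) (V * H + W * F)) 0 := by
  simpa only [loss_eq_crossEntropy] using hasDerivAt_crossEntropy_line Prod.fst W V H F

theorem hasDerivAt_loss_circle :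
    HasDerivAt (fun t : ℝ =>
        loss (Real.cos t • W + Real.sin t • V) (Real.cos t • H + Real.sin t • F))
      (frob (ceGrad Prod.fst (W * H)) (V * H + W * F)) 0 := by
  simpa only [loss_eq_crossEntropy] using hasDerivAt_crossEntropy_circle Prod.fst W V H F

theorem iteratedDeriv_two_loss_line :
    iteratedDeriv 2 (fun t : ℝ => loss (W + t • V) (H + t • F)) 0
      = factorHess Prod.fst W H V F := by
  simpa only [loss_eq_crossEntropy] using iteratedDeriv_two_crossEntropy_line Prod.fst W V H F

theorem iteratedDeriv_two_loss_circle :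
    iteratedDeriv 2 (fun t : ℝ =>
        loss (Real.cos t • W + Real.sin t • V) (Real.cos t • H + Real.sin t • F)) 0
      = factorHess Prod.fst W H V F - 2 * frob (ceGrad Prod.fst (W * H)) (W * H) := by
  simpa only [loss_eq_crossEntropy] using iteratedDeriv_two_crossEntropy_circle Prod.fst W V H F

end LossCurves

section Sphere

variable {K n d : ℕ} {W V : Classifiers K d} {H F : Features K n d}

theorem mem_tangentSpace : (V, F) ∈ tangentSpace W H ↔ frob W V + frob H F = 0 := Iff.rfl

theorem smul_mem_tangentSpace (r : ℝ) (hT : (V, F) ∈ tangentSpace W H) :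
    (r • V, r • F) ∈ tangentSpace W H := by
  rw [mem_tangentSpace] at hT ⊢
  rw [map_smul, map_smul, ← smul_add, hT, smul_zero]

theorem normSq_eq_frob (W : Classifiers K d) (H : Features K n d) :
    normSq W H = frob W W + frob H H := by
  rw [normSq, frob_self, frob_self]

theorem normSq_pos (h : (W, H) ≠ 0) : 0 < normSq W H := by
  rcases not_and_or.1 (mt Prod.mk_eq_zero.2 h) with hW | hH
  · exact add_pos_of_pos_of_nonneg (pow_pos (norm_pos_iff.2 hW) 2) (sq_nonneg _)
  · exact add_pos_of_nonneg_of_pos (sq_nonneg _) (pow_pos (norm_pos_iff.2 hH) 2)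

theorem normSq_smul (r : ℝ) (W : Classifiers K d) (H : Features K n d) :
    normSq (r • W) (r • H) = r ^ 2 * normSq W H := by
  simp only [normSq_eq_frob, map_smul, LinearMap.smul_apply, smul_eq_mul]
  ring

theorem normSq_smul_add_smul (hT : (V, F) ∈ tangentSpace W H) (a b : ℝ) :
    normSq (a • W + b • V) (a • H + b • F) = a ^ 2 * normSq W H + b ^ 2 * normSq V F := by
  rw [mem_tangentSpace] at hT
  simp only [normSq_eq_frob, map_add, map_smul, LinearMap.add_apply, LinearMap.smul_apply,
    smul_eq_mul, frob_comm V W, frob_comm F H]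
  linear_combination 2 * a * b * hT

theorem exists_normSq_smul_eq (h0 : (W, H) ≠ 0) (hVF : (V, F) ≠ 0) :
    ∃ r : ℝ, 0 < r ∧ r ^ 2 * normSq V F = normSq W H ∧ normSq (r • V) (r • F) = normSq W H := by
  have hpos := normSq_pos hVF
  have hratio := div_pos (normSq_pos h0) hpos
  have hr : √(normSq W H / normSq V F) ^ 2 * normSq V F = normSq W H := by
    rw [Real.sq_sqrt hratio.le, div_mul_cancel₀ _ hpos.ne']
  refine ⟨_, Real.sqrt_pos.2 hratio, hr, ?_⟩
  rw [normSq_smul, hr]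

variable [NeZero K]

theorem isTangentStrictSaddle (hK : 2 ≤ K) (hn : 1 ≤ n) (hd : K ≤ d + 1)
    (hWH : ¬ IsNeuralCollapse W H ∨ ‖W‖ ≠ ‖H‖) (hc : IsTangentCritical W H) :
    IsTangentStrictSaddle W H := by
  obtain ⟨lam, h, h0⟩ := exists_hasMultiplier fun V F hT =>
    (hasDerivAt_loss_line W V H F).deriv.symm.trans (hc (V, F) hT)
  obtain ⟨V, F, hT, hneg, hneg'⟩ := h.exists_negative_direction h0 hK hn hd hWH
  refine ⟨hc, ⟨(V, F), hT, by rwa [iteratedDeriv_two_loss_line]⟩, fun hWH0 => ?_⟩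
  have hVF : (V, F) ≠ 0 := by
    rintro hVF
    obtain ⟨rfl, rfl⟩ := Prod.mk_eq_zero.1 hVF
    simp [factorHess, ceHess_zero] at hneg
  obtain ⟨r, hr, hsq, hnorm⟩ := exists_normSq_smul_eq hWH0 hVF
  refine ⟨(r • V, r • F), smul_mem_tangentSpace r hT, hnorm, ?_⟩
  have hcircle : factorHess Prod.fst W H (r • V) (r • F)
      - 2 * frob (ceGrad Prod.fst (W * H)) (W * H)
      = r ^ 2 * (factorHess Prod.fst W H V F + lam * (frob V V + frob F F)) := by
    rw [normSq_eq_frob, normSq_eq_frob] at hsq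
    rw [factorHess_smul]
    linear_combination -h.frob_ceGrad_mul_eq_left - h.frob_ceGrad_mul_eq_right - lam * hsq
  rw [iteratedDeriv_two_loss_circle, hcircle]
  exact mul_neg_of_pos_of_neg (pow_pos hr 2) hneg'

theorem exists_deriv_loss_line_neg (hc : ¬ IsTangentCritical W H) :
    ∃ Δ ∈ tangentSpace W H, deriv (fun t : ℝ => loss (W + t • Δ.1) (H + t • Δ.2)) 0 < 0 := by
  simp only [IsTangentCritical, not_forall] at hc
  obtain ⟨Δ, hT, hne⟩ := hc
  rcases lt_or_gt_of_ne hne with hneg | hpos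
  · exact ⟨Δ, hT, hneg⟩
  · refine ⟨((-1 : ℝ) • Δ.1, (-1 : ℝ) • Δ.2), smul_mem_tangentSpace (-1) hT, ?_⟩
    rw [(hasDerivAt_loss_line W _ H _).deriv] at hpos ⊢
    rw [Matrix.smul_mul, Matrix.mul_smul, ← smul_add, map_smul, smul_eq_mul]
    linarith

theorem exists_deriv_loss_circle_neg (h0 : (W, H) ≠ 0) (hc : ¬ IsTangentCritical W H) :
    ∃ Δ ∈ tangentSpace W H, normSq Δ.1 Δ.2 = normSq W H ∧ deriv (fun t : ℝ =>
      loss (Real.cos t • W + Real.sin t • Δ.1) (Real.cos t • H + Real.sin t • Δ.2)) 0 < 0 := by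
  obtain ⟨⟨V, F⟩, hT, hneg⟩ := exists_deriv_loss_line_neg hc
  have hVF : (V, F) ≠ 0 := by
    rintro hVF
    obtain ⟨rfl, rfl⟩ := Prod.mk_eq_zero.1 hVF
    simp at hneg
  rw [(hasDerivAt_loss_line W V H F).deriv] at hneg
  obtain ⟨r, hr, -, hnorm⟩ := exists_normSq_smul_eq h0 hVF
  refine ⟨(r • V, r • F), smul_mem_tangentSpace r hT, hnorm, ?_⟩
  rw [(hasDerivAt_loss_circle W (r • V) H (r • F)).deriv, Matrix.smul_mul, Matrix.mul_smul,
    ← smul_add, map_smul]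
  exact mul_neg_of_pos_of_neg hr hneg

end Sphere

section DescentDirections

open Filter Topology

variable {K n d : ℕ} [NeZero K] {W : Classifiers K d} {H : Features K n d}

theorem exists_eventually_loss_line_lt (h : IsTangentCritical W H → IsTangentStrictSaddle W H) :
    ∃ Δ ∈ tangentSpace W H, ∀ᶠ t : ℝ in 𝓝[>] 0, loss (W + t • Δ.1) (H + t • Δ.2) < loss W H := by
  by_cases hc : IsTangentCritical W H
  · obtain ⟨-, ⟨Δ, hT, hneg⟩, -⟩ := h hc
    have hcont := (hasDerivAt_loss_line W Δ.1 H Δ.2).continuousAt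
    exact ⟨Δ, hT, by simpa using eventually_lt_of_iteratedDeriv_two_neg hcont (hc Δ hT) hneg⟩
  · obtain ⟨Δ, hT, hneg⟩ := exists_deriv_loss_line_neg hc
    exact ⟨Δ, hT, by simpa using eventually_lt_of_deriv_neg hneg⟩

theorem exists_eventually_loss_circle_lt (h : IsTangentCritical W H → IsTangentStrictSaddle W H)
    (h0 : (W, H) ≠ 0) :
    ∃ Δ ∈ tangentSpace W H, normSq Δ.1 Δ.2 = normSq W H ∧ ∀ᶠ t : ℝ in 𝓝[>] 0,
      loss (Real.cos t • W + Real.sin t • Δ.1) (Real.cos t • H + Real.sin t • Δ.2)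
        < loss W H := by
  by_cases hc : IsTangentCritical W H
  · obtain ⟨Δ, hT, hnorm, hneg⟩ := (h hc).2.2 h0
    have hcircle := hasDerivAt_loss_circle W Δ.1 H Δ.2
    have hderiv := hcircle.deriv.trans
      ((hasDerivAt_loss_line W Δ.1 H Δ.2).deriv.symm.trans (hc Δ hT))
    exact ⟨Δ, hT, hnorm, by
      simpa using eventually_lt_of_iteratedDeriv_two_neg hcircle.continuousAt hderiv hneg⟩
  · obtain ⟨Δ, hT, hnorm, hneg⟩ := exists_deriv_loss_circle_neg h0 hc
    exact ⟨Δ, hT, hnorm, by simpa using eventually_lt_of_deriv_neg hneg⟩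

theorem exists_loss_line_lt (h : IsTangentCritical W H → IsTangentStrictSaddle W H) :
    ∃ Δ ∈ tangentSpace W H, ∃ M : ℝ, 0 < M ∧ ∀ δ : ℝ, 0 < δ → δ < M →
      loss (W + δ • Δ.1) (H + δ • Δ.2) < loss W H := by
  obtain ⟨Δ, hT, hlt⟩ := exists_eventually_loss_line_lt h
  obtain ⟨M, hM, hsub⟩ := mem_nhdsGT_iff_exists_Ioo_subset.1 hlt
  exact ⟨Δ, hT, M, hM, fun δ hδ hδM => hsub ⟨hδ, hδM⟩⟩

theorem exists_loss_lt_of_normSq_sub_lt (h : IsTangentCritical W H → IsTangentStrictSaddle W H)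
    (h0 : (W, H) ≠ 0) {ε : ℝ} (hε : 0 < ε) :
    ∃ W' H', normSq W' H' = normSq W H ∧ normSq (W' - W) (H' - H) < ε ∧
      loss W' H' < loss W H := by
  obtain ⟨⟨V, F⟩, hT, hnorm, hlt⟩ := exists_eventually_loss_circle_lt h h0
  have hcont : Continuous fun t : ℝ => ((Real.cos t - 1) ^ 2 + Real.sin t ^ 2) * normSq W H := by
    fun_prop
  have hnear : ∀ᶠ t : ℝ in 𝓝[>] 0,
      ((Real.cos t - 1) ^ 2 + Real.sin t ^ 2) * normSq W H < ε :=
    nhdsWithin_le_nhds (hcont.continuousAt.eventually_lt_const (by simpa using hε))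
  obtain ⟨t, hloss, hdist⟩ := (hlt.and hnear).exists
  refine ⟨_, _, ?_, ?_, hloss⟩
  · rw [normSq_smul_add_smul hT, hnorm, ← add_mul, Real.cos_sq_add_sin_sq, one_mul]
  · have hsub {l o : Type} (A B : Matrix l o ℝ) :
        Real.cos t • A + Real.sin t • B - A = (Real.cos t - 1) • A + Real.sin t • B := by
      rw [sub_smul, one_smul, add_sub_right_comm]
    rwa [hsub, hsub, normSq_smul_add_smul hT, hnorm, ← add_mul]

end DescentDirections

end ULPM

theorem mainTheorem5 (K n d : ℕ) (hK : 2 ≤ K) (hn : 1 ≤ n) (hd : K ≤ d + 1)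
    (W : ULPM.Classifiers K d) (H : ULPM.Features K n d)
    (hWH : ¬ ULPM.IsNeuralCollapse W H ∨ ‖W‖ ≠ ‖H‖) :
    (∃ Δ ∈ ULPM.tangentSpace W H, ∃ M : ℝ, 0 < M ∧ ∀ δ : ℝ, 0 < δ → δ < M →
      ULPM.loss (W + δ • Δ.1) (H + δ • Δ.2) < ULPM.loss W H) ∧
    ((W, H) ≠ 0 → ∀ ε : ℝ, 0 < ε →
      ∃ (W' : ULPM.Classifiers K d) (H' : ULPM.Features K n d),
        ‖W'‖ ^ 2 + ‖H'‖ ^ 2 = ‖W‖ ^ 2 + ‖H‖ ^ 2 ∧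
        ‖W' - W‖ ^ 2 + ‖H' - H‖ ^ 2 < ε ∧
        ULPM.loss W' H' < ULPM.loss W H) ∧
    (ULPM.IsTangentCritical W H → ULPM.IsTangentStrictSaddle W H) := by
  have : NeZero K := ⟨by lia⟩
  have hs := ULPM.isTangentStrictSaddle hK hn hd hWH
  exact ⟨ULPM.exists_loss_line_lt hs,
    fun h0 ε hε => ULPM.exists_loss_lt_of_normSq_sub_lt hs h0 hε, hs⟩
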